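/- For $f\colon\{0,1\}^n\to\{0,1\}$ let $\varepsilon(f)=\min_g \Pr_{x}[f(x)\neq g(x)]$, where $x$ is uniform in $\{0,1\}^n$ and the minimum is over all functions $g\colon\{0,1\}^n\to\{0,1\}$ that are monotone for the coordinatewise order. There are absolute constants $\delta,c,C>0$ such that for all $\varepsilon>0$ and all $n\in\mathbb{N}$ the following holds. Write $2^{\Theta(1/\varepsilon)}$ for any real number in $[2^{cL},2^{CL}]$, where $L=\max(1,1/\varepsilon)$ (so $L=1/\varepsilon$ for $\varepsilon\le 1$). There are an integer $n'$ and a randomized transformation (using finitely many fair coin tosses) that makes $2^{\Theta(1/\varepsilon)}$ adaptive oracle queries to an arbitrary $f\colon\{0,1\}^n\to\{0,1\}$ and produces oracle access to a function $f'\colon\{0,1\}^{n'}\to\{0,1\}$ (which is determined by $f$ and the coin tosses), such that: 1. $n'=n\cdot 2^{\Theta(1/\varepsilon)}$, and any single query to $f'$ is answered by a procedure making $2^{\Theta(1/\varepsilon)}$ adaptive queries to $f$. 2. If $f$ is monotone, then with probability $1$ the function $f'$ is monotone. 3. If $\varepsilon(f)\ge\varepsilon$, then with probability at least $0.99$ we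 have $\varepsilon(f')\ge\delta$. The number $n'$ and the transformation depend only on $n$ and $\varepsilon$, not on $f$. -/

import Mathlib

namespace MonoAmp

/-- The Boolean hypercube `{0,1}^n`. The product order (with `false ≤ true`) is the
coordinatewise order. -/
abbrev Cube (n : ℕ) : Type := Fin n → Bool

open Classical in
/-- The probability of the event `P` under the uniform distribution on the finite type `Ω`. -/
noncomputable def unifProb {Ω : Type} [Fintype Ω] (P : Ω → Prop) : ℝ :=
  ((Finset.univ.filter P).card : ℝ) / (Fintype.card Ω : ℝ)

/-- The distance of `f` from monotonicity: the minimum over all monotone `g` of the fraction of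
points at which `f` and `g` differ. The infimum ranges over a finite nonempty family, so it is a
minimum. -/
noncomputable def monoDist {n : ℕ} (f : Cube n → Bool) : ℝ :=
  ⨅ g : {g : Cube n → Bool // Monotone g}, unifProb (fun x => f x ≠ g.1 x)

/-- Deterministic adaptive query algorithms (decision trees) with access to an oracle
`X → Bool` and with an output in `α`. -/
inductive QueryAlg (X α : Type) : Type
  | output (a : α) : QueryAlg X α
  | query (x : X) (next : Bool → QueryAlg X α) : QueryAlg X α

/-- The output of a query algorithm when its oracle is `f`. -/
def QueryAlg.run {X α : Type} (f : X → Bool) : QueryAlg X α → α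
  | .output a => a
  | .query x next => (next (f x)).run f

/-- The number of oracle queries a query algorithm makes when its oracle is `f`
(repeated queries are counted each time). -/
def QueryAlg.numQueries {X α : Type} (f : X → Bool) : QueryAlg X α → ℕ
  | .output _ => 0
  | .query x next => (next (f x)).numQueries f + 1

/-- A randomized oracle transformation from functions on `{0,1}^n` to functions on `{0,1}^n'`.
It tosses `numCoins` fair coins, queries the given function `f`, and then outputs oracle access to
a new function `f'`, that is, for every point `z` of `{0,1}^n'` a query algorithm (with oracle
`f`) which computes `f' z`. Once the coins are fixed the new function is determined. -/
structure OracleTransform (n n' : ℕ) where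
  numCoins : ℕ
  alg : (Fin numCoins → Bool) → QueryAlg (Cube n) (Cube n' → QueryAlg (Cube n) Bool)

namespace OracleTransform

variable {n n' : ℕ}

/-- The procedure answering the query `z` to the new function, for coins `r` and oracle `f`. -/
def simulator (T : OracleTransform n n') (r : Fin T.numCoins → Bool) (f : Cube n → Bool)
    (z : Cube n') : QueryAlg (Cube n) Bool :=
  (T.alg r).run f z

/-- The function `f'` produced from `f` when the coins are `r`. -/
def result (T : OracleTransform n n') (r : Fin T.numCoins → Bool) (f : Cube n → Bool) :
    Cube n' → Bool :=
  fun z => (T.simulator r f z).run f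

/-- The number of queries made in producing the oracle access to the new function. -/
def setupQueries (T : OracleTransform n n') (r : Fin T.numCoins → Bool) (f : Cube n → Bool) : ℕ :=
  (T.alg r).numQueries f

/-- The number of queries to `f` made in answering the single query `z` to the new function. -/
def simQueries (T : OracleTransform n n') (r : Fin T.numCoins → Bool) (f : Cube n → Bool)
    (z : Cube n') : ℕ :=
  (T.simulator r f z).numQueries f

end OracleTransform

/-- `q` has the form `2^{Θ(1/ε)}` with implied constants `c` and `C`. For `ε ≤ 1` this says
`2^{c/ε} ≤ q ≤ 2^{C/ε}`; for `ε > 1`, where these bounds need not contain any integer,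
`1/ε` is replaced by `1`. -/
def TwoPowTheta (c C ε q : ℝ) : Prop :=
  (2 : ℝ) ^ (c * max 1 (1 / ε)) ≤ q ∧ q ≤ (2 : ℝ) ^ (C * max 1 (1 / ε))

end MonoAmp

/-!
The new function is a disjunction of `N` conjunctions ("tribes"), each of `k ≈ 8/ε` independent
copies of `h`, where `h(x, y) = f(x) ∨ y₀`. It is built from `f` by monotone operations, hence
monotone whenever `f` is.

Distance from monotonicity is witnessed by a matching of violations (`IsViolMatching`): disjoint
pairs `x ≤ σ x` with `h x = 1` and `h (σ x) = 0`. A monotone function differs from `h` on every such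
pair, and conversely a maximal matching has density at least `ε(f)/2` (`exists_violMatching`).
Let `p ∈ [1/2, 1)` be the density of `h` and `a ≥ ε/4` that of its matching.

* Conjunction (`IsViolMatching.andPower`): a satisfied conjunction with some coordinate in the
  matching is falsified by moving this coordinate, and the moved coordinate is the only failing one.
  The density of this matching is `γ = p^k - (p - a)^k`, at least `p^k / 2` since `a k ≥ 2`.
* Disjunction (`IsViolMatching.orOver`): if exactly one term is satisfied, it is matched, and no
  other term is an upper point of the matching, then moving that term falsifies the disjunction, and
  the moved term is the only one that is an upper point. The density is
  `N γ (1 - p^k - γ)^(N-1)`, which is bounded below as soon as `p^k ≤ 1/4` and `N p^k` is bounded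
  above and below. The former follows from `p ≤ 1 - a` and `a k ≥ 2`.

Thus `N ≈ p^(-k)` is needed. Since `p ≥ 1/2`, which is the purpose of the padding bit `y₀`, this is
at most `2^k`, and it suffices to know `p` up to an error `1/(2k)`. Such an estimate comes from
`4^k` samples of `f` by Chebyshev's inequality (`unifProb_abs_freq_sub_le`). The conjunctions beyond
the first `N` of the `2^k` available ones are dummy variables, so that `n' = 2n · k 2^k` does not
depend on `f`.
-/

namespace MonoAmp

/-! ### Matchings of violations of monotonicity -/

/-- A matching of violations of monotonicity of `h`: the points `x ∈ L` are matched with the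
points `σ x`, and every pair `x ≤ σ x` satisfies `h x = true` and `h (σ x) = false`. Values of `σ`
outside `L` are irrelevant. -/
structure IsViolMatching {X : Type} [Preorder X] (h : X → Bool) (L : Finset X) (σ : X → X) :
    Prop where
  injOn : Set.InjOn σ L
  le : ∀ x ∈ L, x ≤ σ x
  high : ∀ x ∈ L, h x = true
  low : ∀ x ∈ L, h (σ x) = false

/-- Every matched pair contains a point at which a monotone function must differ from `h`. -/
theorem IsViolMatching.card_le_card_ne {X : Type} [Fintype X] [Preorder X]
    {h : X → Bool} {L : Finset X} {σ : X → X} (hm : IsViolMatching h L σ)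
    {g : X → Bool} (hg : Monotone g) :
    L.card ≤ (Finset.univ.filter fun x => h x ≠ g x).card := by
  classical
  refine Finset.card_le_card_of_injOn (fun x => if g x = true then σ x else x) ?_ ?_
  · intro x hx
    have hx : x ∈ L := hx
    have h1 := hm.high x hx
    have h2 := hm.low x hx
    by_cases hgx : g x = true
    · have h3 : g (σ x) = true := by
        have := hg (hm.le x hx)
        rw [hgx] at this
        exact le_antisymm (Bool.le_true _) this
      simp [hgx, h2, h3]
    · simp [hgx, h1]
  · intro x hx y hy hxy
    have hx : x ∈ L := hx
    have hy : y ∈ L := hy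
    have h1 := hm.high x hx
    have h2 := hm.low x hx
    have h3 := hm.high y hy
    have h4 := hm.low y hy
    by_cases hgx : g x = true <;> by_cases hgy : g y = true <;> simp [hgx, hgy] at hxy
    · exact hm.injOn hx hy hxy
    · rw [hxy, h3] at h2; simp at h2
    · rw [← hxy, h1] at h4; simp at h4
    · exact hxy

/-- A maximal matching `L` of violations covers all violations, so that `f` can be made monotone by
changing it only at the `2 |L|` endpoints of the matching. -/
theorem exists_violMatching {X : Type} [Fintype X] [Preorder X] (f : X → Bool) :
    ∃ (L : Finset X) (σ : X → X) (g : X → Bool), IsViolMatching f L σ ∧ Monotone g ∧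
      (Finset.univ.filter fun x => f x ≠ g x).card ≤ 2 * L.card := by
  classical
  let P : ℕ → Prop := fun m => ∃ (L : Finset X) (σ : X → X), IsViolMatching f L σ ∧ L.card = m
  have hP0 : P 0 := ⟨∅, id, ⟨by simp, by simp, by simp, by simp⟩, rfl⟩
  have hbound : ∀ m, P m → m ≤ Fintype.card X := by
    rintro m ⟨L, σ, -, rfl⟩
    exact Finset.card_le_univ L
  obtain ⟨L, σ, hm, hL⟩ : P (Nat.findGreatest P (Fintype.card X)) :=
    Nat.findGreatest_spec (Nat.zero_le _) hP0
  let C : Finset X := L ∪ L.image σ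
  refine ⟨L, σ, fun x => decide (∃ u, u ∉ C ∧ u ≤ x ∧ f u = true), hm, ?_, ?_⟩
  · intro x y hxy
    simp only [Bool.le_iff_imp, decide_eq_true_eq]
    rintro ⟨u, hu, hux, hfu⟩
    exact ⟨u, hu, hux.trans hxy, hfu⟩
  · refine (Finset.card_le_card (t := C) ?_).trans ?_
    · intro v hv
      by_contra hvC
      refine (Finset.mem_filter.1 hv).2 ?_
      cases hfv : f v with
      | true => exact (decide_eq_true ⟨v, hvC, le_rfl, hfv⟩).symm
      | false =>
        refine (decide_eq_false ?_).symm
        rintro ⟨u, hu, huv, hfu⟩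
        -- The violation `u ≤ v` avoids the matching and could be added to it.
        have huL : u ∉ L := fun h => hu (Finset.mem_union_left _ h)
        have hvL : ∀ x ∈ L, σ x ≠ v := fun x hx h =>
          hvC (Finset.mem_union_right _ (Finset.mem_image.2 ⟨x, hx, h⟩))
        have hne : ∀ x ∈ L, x ≠ u := fun x hx h => huL (h ▸ hx)
        have hm' : IsViolMatching f (insert u L) (Function.update σ u v) := by
          refine ⟨?_, ?_, ?_, ?_⟩
          · intro x hx y hy hxy
            rcases Finset.mem_insert.1 hx with hxu | hxL <;>
              rcases Finset.mem_insert.1 hy with hyu | hyL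
            · rw [hxu, hyu]
            · rw [hxu, Function.update_self, Function.update_of_ne (hne y hyL)] at hxy
              exact (hvL y hyL hxy.symm).elim
            · rw [hyu, Function.update_self, Function.update_of_ne (hne x hxL)] at hxy
              exact (hvL x hxL hxy).elim
            · rw [Function.update_of_ne (hne x hxL), Function.update_of_ne (hne y hyL)] at hxy
              exact hm.injOn hxL hyL hxy
          · intro x hx
            rcases Finset.mem_insert.1 hx with rfl | hx
            · rwa [Function.update_self]
            · rw [Function.update_of_ne (hne x hx)]; exact hm.le x hx
          · intro x hx
            rcases Finset.mem_insert.1 hx with rfl | hx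
            · exact hfu
            · exact hm.high x hx
          · intro x hx
            rcases Finset.mem_insert.1 hx with rfl | hx
            · rwa [Function.update_self]
            · rw [Function.update_of_ne (hne x hx)]; exact hm.low x hx
        have hPs : P (L.card + 1) :=
          ⟨_, _, hm', Finset.card_insert_of_notMem huL⟩
        have := Nat.le_findGreatest (hbound _ hPs) hPs
        omega
    · calc C.card ≤ L.card + (L.image σ).card := Finset.card_union_le _ _
        _ ≤ L.card + L.card := Nat.add_le_add_left Finset.card_image_le _
        _ = 2 * L.card := by ring

/-! ### Matchings for conjunctions and disjunctions -/

/-- The conjunction of the values of `h` at the coordinates of a point. -/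
def andPower {X I : Type} [Fintype I] (h : X → Bool) (w : I → X) : Bool :=
  decide (∀ i, h (w i) = true)

/-- The disjunction of the values of `H` at the coordinates with index in `S`; the remaining
coordinates are dummy variables. -/
def orOver {W J : Type} (S : Finset J) (H : W → Bool) (z : J → W) : Bool :=
  decide (∃ j ∈ S, H (z j) = true)

theorem monotone_andPower {X I : Type} [Fintype I] [Preorder X] {h : X → Bool} (hh : Monotone h) :
    Monotone (andPower h : (I → X) → Bool) := by
  intro w w' hw
  simp only [andPower, Bool.le_iff_imp, decide_eq_true_eq]
  exact fun H i => Bool.le_iff_imp.1 (hh (hw i)) (H i)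

theorem monotone_orOver {W J : Type} [Preorder W] (S : Finset J) {H : W → Bool}
    (hH : Monotone H) : Monotone (orOver S H) := by
  intro z z' hz
  simp only [orOver, Bool.le_iff_imp, decide_eq_true_eq]
  rintro ⟨j, hj, hHj⟩
  exact ⟨j, hj, Bool.le_iff_imp.1 (hH (hz j)) hHj⟩

theorem card_andPower {X I : Type} [Fintype X] [Fintype I] [DecidableEq I] (h : X → Bool) :
    (Finset.univ.filter fun w : I → X => andPower h w = true).card =
      (Finset.univ.filter fun x => h x = true).card ^ Fintype.card I := by
  classical
  rw [← Finset.card_univ, ← Finset.prod_const, ← Fintype.card_piFinset]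
  congr 1
  ext w
  simp [andPower]

/-- A satisfied conjunction that has a coordinate in `L` is falsified by moving that coordinate
along the matching. The pair is recovered from its upper point, whose moved coordinate is the only
one at which `h` fails. -/
theorem IsViolMatching.andPower {X I : Type} [Fintype X] [Fintype I] [DecidableEq I]
    [Preorder X]
    {h : X → Bool} {L : Finset X} {σ : X → X} (hm : IsViolMatching h L σ) :
    ∃ (G : Finset (I → X)) (φ : (I → X) → (I → X)), IsViolMatching (andPower h) G φ ∧
      G.card + ((Finset.univ.filter fun x => h x = true).card - L.card) ^ Fintype.card I =
        (Finset.univ.filter fun x => h x = true).card ^ Fintype.card I := by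
  classical
  let G : Finset (I → X) := Finset.univ.filter fun w => (∀ i, h (w i) = true) ∧ ∃ i, w i ∈ L
  have hG : ∀ w ∈ G, (∀ i, h (w i) = true) ∧ ∃ i, w i ∈ L := fun w hw => (Finset.mem_filter.1 hw).2
  have hch : ∀ w : I → X, ∃ w' : I → X, w ∈ G →
      ∃ i, w i ∈ L ∧ w' = Function.update w i (σ (w i)) := by
    intro w
    by_cases hw : w ∈ G
    · obtain ⟨-, i, hi⟩ := hG w hw
      exact ⟨_, fun _ => ⟨i, hi, rfl⟩⟩
    · exact ⟨w, fun h => (hw h).elim⟩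
  choose φ hφ using hch
  refine ⟨G, φ, ⟨?_, ?_, ?_, ?_⟩, ?_⟩
  · intro w hw w' hw' heq
    obtain ⟨i, hi, e⟩ := hφ w hw
    obtain ⟨i', hi', e'⟩ := hφ w' hw'
    rw [e, e'] at heq
    have hii : i = i' := by
      by_contra hne
      have := congrFun heq i
      rw [Function.update_self, Function.update_of_ne hne] at this
      have h1 := hm.low _ hi
      rw [this, (hG w' hw').1 i] at h1
      simp at h1
    subst hii
    funext l
    by_cases hl : l = i
    · subst hl
      have := congrFun heq l
      rw [Function.update_self, Function.update_self] at this
      exact hm.injOn hi hi' this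
    · have := congrFun heq l
      rwa [Function.update_of_ne hl, Function.update_of_ne hl] at this
  · intro w hw
    obtain ⟨i, hi, e⟩ := hφ w hw
    rw [e, le_update_iff]
    exact ⟨hm.le _ hi, fun _ _ => le_rfl⟩
  · intro w hw
    exact decide_eq_true (hG w hw).1
  · intro w hw
    obtain ⟨i, hi, e⟩ := hφ w hw
    refine decide_eq_false fun H => ?_
    have := H i
    rw [e, Function.update_self, hm.low _ hi] at this
    simp at this
  · have hLH : L ⊆ Finset.univ.filter fun x => h x = true := fun x hx => by
      simpa using hm.high x hx
    rw [← Finset.card_sdiff_of_subset hLH, ← Finset.card_univ, ← Finset.prod_const,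
      ← Finset.prod_const, ← Fintype.card_piFinset, ← Fintype.card_piFinset,
      ← Finset.card_union_of_disjoint]
    · congr 1
      ext w
      simp only [G, Finset.mem_union, Finset.mem_filter, Finset.mem_univ, true_and,
        Fintype.mem_piFinset, Finset.mem_sdiff]
      constructor
      · rintro (H | H)
        · exact H.1
        · exact fun i => (H i).1
      · intro H
        by_cases hL : ∃ i, w i ∈ L
        · exact Or.inl ⟨H, hL⟩
        · exact Or.inr fun i => ⟨H i, fun h => hL ⟨i, h⟩⟩
    · rw [Finset.disjoint_left]
      intro w hw hw'
      obtain ⟨-, i, hi⟩ := hG w hw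
      exact (Finset.mem_sdiff.1 (Fintype.mem_piFinset.1 hw' i)).2 hi

/-- If exactly one term of a disjunction is satisfied and lies in `G`, and no other term is an
upper point of the matching, then moving that term along the matching falsifies the disjunction.
The moved term is the only active one that is an upper point, so the pair is recovered from its
upper point. -/
theorem IsViolMatching.orOver {W J : Type} [Fintype W] [Nonempty W] [Fintype J] [DecidableEq J]
    [Preorder W]
    {H : W → Bool} {G : Finset W} {φ : W → W} (hm : IsViolMatching H G φ) (S : Finset J) :
    ∃ (A : Finset (J → W)) (Φ : (J → W) → (J → W)), IsViolMatching (orOver S H) A Φ ∧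
      (A.card : ℝ) / Fintype.card (J → W) =
        S.card * ((G.card : ℝ) / Fintype.card W) *
          (1 - ((Finset.univ.filter fun w => H w = true).card : ℝ) / Fintype.card W -
            (G.card : ℝ) / Fintype.card W) ^ (S.card - 1) := by
  classical
  let B : Finset W := Finset.univ.filter fun w => H w = false ∧ w ∉ G.image φ
  have hB : ∀ w ∈ B, H w = false ∧ w ∉ G.image φ := fun w hw => (Finset.mem_filter.1 hw).2
  have hGB : ∀ w ∈ G, w ∉ B := fun w hw hw' => by
    have := hm.high w hw
    rw [(hB w hw').1] at this
    simp at this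
  let c : J → J → Finset W := fun j l => if l = j then G else if l ∈ S then B else Finset.univ
  let A : Finset (J → W) := S.biUnion fun j => Fintype.piFinset (c j)
  have hA : ∀ z, z ∈ A ↔ ∃ j ∈ S, z j ∈ G ∧ ∀ l ∈ S, l ≠ j → z l ∈ B := by
    intro z
    simp only [A, Finset.mem_biUnion, Fintype.mem_piFinset]
    refine exists_congr fun j => and_congr_right fun hj => ⟨fun h => ⟨?_, fun l hl hlj => ?_⟩, ?_⟩
    · simpa [c] using h j
    · simpa [c, hl, hlj] using h l
    · rintro ⟨h1, h2⟩ l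
      by_cases hlj : l = j
      · simpa [c, hlj] using h1
      · by_cases hl : l ∈ S
        · simpa [c, hl, hlj] using h2 l hl hlj
        · simp [c, hl, hlj]
  have hch : ∀ z : J → W, ∃ z' : J → W, z ∈ A → ∃ j ∈ S, z j ∈ G ∧
      (∀ l ∈ S, l ≠ j → z l ∈ B) ∧ z' = Function.update z j (φ (z j)) := by
    intro z
    by_cases hz : z ∈ A
    · obtain ⟨j, hj, h1, h2⟩ := (hA z).1 hz
      exact ⟨_, fun _ => ⟨j, hj, h1, h2, rfl⟩⟩
    · exact ⟨z, fun h => (hz h).elim⟩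
  choose Φ hΦ using hch
  refine ⟨A, Φ, ⟨?_, ?_, ?_, ?_⟩, ?_⟩
  · intro z hz z' hz' heq
    obtain ⟨j, hjS, hj, hB1, e⟩ := hΦ z hz
    obtain ⟨j', hjS', hj', hB2, e'⟩ := hΦ z' hz'
    rw [e, e'] at heq
    have hjj : j = j' := by
      by_contra hne
      have := congrFun heq j
      rw [Function.update_self, Function.update_of_ne hne] at this
      exact (hB _ (hB2 j hjS hne)).2 (Finset.mem_image.2 ⟨_, hj, this⟩)
    subst hjj
    funext l
    by_cases hl : l = j
    · subst hl
      have := congrFun heq l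
      rw [Function.update_self, Function.update_self] at this
      exact hm.injOn hj hj' this
    · have := congrFun heq l
      rwa [Function.update_of_ne hl, Function.update_of_ne hl] at this
  · intro z hz
    obtain ⟨j, -, hj, -, e⟩ := hΦ z hz
    rw [e, le_update_iff]
    exact ⟨hm.le _ hj, fun _ _ => le_rfl⟩
  · intro z hz
    obtain ⟨j, hjS, hj, -, -⟩ := hΦ z hz
    exact decide_eq_true ⟨j, hjS, hm.high _ hj⟩
  · intro z hz
    obtain ⟨j, hjS, hj, hB1, e⟩ := hΦ z hz
    refine decide_eq_false ?_
    rintro ⟨l, hl, hHl⟩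
    rw [e] at hHl
    by_cases hlj : l = j
    · subst hlj
      rw [Function.update_self, hm.low _ hj] at hHl
      simp at hHl
    · rw [Function.update_of_ne hlj, (hB _ (hB1 l hl hlj)).1] at hHl
      simp at hHl
  · have hW : (Fintype.card W : ℝ) ≠ 0 := by exact_mod_cast Fintype.card_ne_zero
    have hBcard : (B.card : ℝ) / Fintype.card W =
        1 - ((Finset.univ.filter fun w => H w = true).card : ℝ) / Fintype.card W -
            (G.card : ℝ) / Fintype.card W := by
      have h1 : B = (Finset.univ.filter fun w => H w = false) \ G.image φ := by
        ext w; simp [B]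
      have h2 : G.image φ ⊆ Finset.univ.filter fun w => H w = false := by
        intro w hw
        obtain ⟨x, hx, rfl⟩ := Finset.mem_image.1 hw
        simpa using hm.low x hx
      have h3 : B.card + G.card = (Finset.univ.filter fun w => H w = false).card := by
        rw [h1, ← Finset.card_image_of_injOn hm.injOn]
        exact Finset.card_sdiff_add_card_eq_card h2
      have h4 : (Finset.univ.filter fun w => H w = true).card +
          (Finset.univ.filter fun w => H w = false).card = Fintype.card W := by
        rw [← Finset.card_univ,
          ← Finset.card_filter_add_card_filter_not (s := Finset.univ) (fun w => H w = true)]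
        simp
      have h5 : (Fintype.card W : ℝ) = (Finset.univ.filter fun w => H w = true).card +
          (B.card + G.card) := by
        rw [← h4, ← h3]; push_cast; ring
      rw [eq_sub_iff_add_eq, eq_sub_iff_add_eq, ← add_div, ← add_div, div_eq_one_iff_eq hW, h5]
      ring
    rw [← hBcard]
    have hAcard : (A.card : ℝ) = ∑ j ∈ S, ∏ l, ((c j l).card : ℝ) := by
      rw [Finset.card_biUnion]
      · push_cast [Fintype.card_piFinset]
        rfl
      · intro i hi j hj hij
        rw [Function.onFun, Finset.disjoint_left]
        intro z hz hz'
        have h1 : z i ∈ c i i := Fintype.mem_piFinset.1 hz i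
        have h2 : z i ∈ c j i := Fintype.mem_piFinset.1 hz' i
        have hi : i ∈ S := hi
        simp only [c, if_true, hij, if_false, hi] at h1 h2
        exact hGB _ h1 h2
    rw [hAcard, Finset.sum_div, mul_assoc, ← nsmul_eq_mul, ← Finset.sum_const]
    refine Finset.sum_congr rfl fun j hj => ?_
    have hc : ∀ l, ((c j l).card : ℝ) / Fintype.card W = if l = j then (G.card : ℝ) / Fintype.card W
        else if l ∈ S.erase j then (B.card : ℝ) / Fintype.card W else 1 := by
      intro l
      by_cases hlj : l = j
      · simp [c, hlj]
      · by_cases hl : l ∈ S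
        · simp [c, hlj, hl]
        · simp [c, hlj, hl, hW]
    have hcard : (Fintype.card (J → W) : ℝ) = ∏ _l : J, (Fintype.card W : ℝ) := by
      simp
    rw [hcard, ← Finset.prod_div_distrib, Finset.prod_congr rfl fun l _ => hc l,
      Fintype.prod_eq_mul_prod_compl j, if_pos rfl]
    congr 1
    rw [← Finset.card_erase_of_mem hj, ← Finset.prod_const]
    rw [← Finset.prod_subset (s₁ := S.erase j) (s₂ := {j}ᶜ)]
    · refine Finset.prod_congr rfl fun l hl => ?_
      rw [if_neg (Finset.ne_of_mem_erase hl), if_pos hl]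
    · intro l hl
      simpa using Finset.ne_of_mem_erase hl
    · intro l hl hl'
      rw [if_neg (by simpa using hl), if_neg hl']

/-! ### Choice of the number of terms -/

theorem exp_neg_two_mul_le_one_sub {q : ℝ} (h0 : 0 ≤ q) (h1 : q ≤ 1 / 2) :
    Real.exp (-(2 * q)) ≤ 1 - q := by
  rw [Real.exp_neg]
  refine inv_le_of_inv_le₀ (by linarith) ?_
  have h2 := Real.add_one_le_exp (2 * q)
  refine le_trans ?_ h2
  rw [inv_le_iff_one_le_mul₀ (by linarith)]
  nlinarith

/-- If `x` and `y` are at least `1/2` and differ by at most `1/(2k)`, then their `k`-th powers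
agree up to a factor `e`. -/
theorem pow_le_exp_one_mul_pow {k : ℕ} (hk : 0 < k) {x y : ℝ} (hx : 1 / 2 ≤ x) (hy : 0 ≤ y)
    (hxy : y - x ≤ 1 / (2 * k)) : y ^ k ≤ Real.exp 1 * x ^ k := by
  have hk' : (0 : ℝ) < k := by exact_mod_cast hk
  have h1 : y ≤ Real.exp (1 / k) * x := by
    have h2 := Real.add_one_le_exp (1 / (k : ℝ))
    have h3 : (1 : ℝ) / (2 * k) = 1 / k * (1 / 2) := by field_simp
    have h4 : 0 < 1 / (k : ℝ) := by positivity
    nlinarith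
  calc y ^ k ≤ (Real.exp (1 / k) * x) ^ k := pow_le_pow_left₀ hy h1 k
    _ = Real.exp 1 * x ^ k := by
      rw [mul_pow, ← Real.exp_nat_mul]
      congr 2
      field_simp

/-- The number of terms of the disjunction when the density of `h` is estimated to be `x`. It is
chosen such that the expected number of satisfied conjunctions is about `1`. -/
noncomputable def numTerms (k : ℕ) (x : ℝ) : ℕ := ⌈(x ^ k)⁻¹⌉₊

theorem numTerms_le {k : ℕ} {x : ℝ} (hx : 1 / 2 ≤ x) : numTerms k x ≤ 2 ^ k := by
  refine Nat.ceil_le.2 ?_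
  rw [← inv_pow]
  push_cast
  have h1 : x⁻¹ ≤ 2 := by
    rw [inv_le_comm₀ (by linarith) (by norm_num)]; linarith
  exact pow_le_pow_left₀ (by rw [inv_nonneg]; linarith) h1 k

theorem exp_neg_one_le_numTerms_mul {k : ℕ} (hk : 0 < k) {x p : ℝ} (hx : 1 / 2 ≤ x)
    (hp : 1 / 2 ≤ p) (h : |x - p| ≤ 1 / (2 * k)) :
    Real.exp (-1) ≤ numTerms k x * p ^ k := by
  have h1 := pow_le_exp_one_mul_pow hk hp (by linarith : 0 ≤ x) ((le_abs_self _).trans h)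
  have hx0 : 0 < x ^ k := by positivity
  have hp0 : 0 < p ^ k := by positivity
  have h2 : (x ^ k)⁻¹ ≤ numTerms k x := Nat.le_ceil _
  refine le_trans ?_ (mul_le_mul_of_nonneg_right h2 hp0.le)
  rw [Real.exp_neg, inv_mul_eq_div, le_div_iff₀ hx0, inv_mul_le_iff₀ (Real.exp_pos 1)]
  exact h1

theorem numTerms_mul_le {k : ℕ} (hk : 0 < k) {x p : ℝ} (hx : 1 / 2 ≤ x) (hx1 : x ≤ 1)
    (hp : 1 / 2 ≤ p) (h : |x - p| ≤ 1 / (2 * k)) :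
    numTerms k x * p ^ k ≤ 6 := by
  have h1 := pow_le_exp_one_mul_pow hk hx (by linarith : 0 ≤ p)
    ((le_abs_self _).trans (by rwa [abs_sub_comm]))
  have hx0 : 0 < x ^ k := by positivity
  have hp0 : 0 < p ^ k := by positivity
  have hx2 : 1 ≤ (x ^ k)⁻¹ := (one_le_inv₀ hx0).2 (pow_le_one₀ (by linarith) hx1)
  have h2 : (numTerms k x : ℝ) ≤ 2 * (x ^ k)⁻¹ := by
    have := (Nat.ceil_lt_add_one (inv_nonneg.2 hx0.le)).le
    unfold numTerms
    linarith
  have h3 : (x ^ k)⁻¹ * p ^ k ≤ Real.exp 1 := by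
    rw [inv_mul_eq_div, div_le_iff₀ hx0]; exact h1
  have h4 := Real.exp_one_lt_d9
  nlinarith

/-- The density of the matching in the disjunction of `N` conjunctions is bounded below when the
expected number `N * P` of satisfied conjunctions is bounded above and below. -/
theorem exp_neg_le_of_numTerms {N : ℕ} {P γ : ℝ} (h1 : Real.exp (-1) ≤ N * P) (h2 : N * P ≤ 6)
    (hP0 : 0 ≤ P) (hP : P ≤ 1 / 4) (hγ0 : P / 2 ≤ γ) (hγ : γ ≤ P) :
    Real.exp (-26) ≤ N * γ * (1 - P - γ) ^ (N - 1) := by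
  have hN : (0 : ℝ) ≤ N := Nat.cast_nonneg N
  -- The base is at least `1 - 2 P`, and `2 P ≤ 1 / 2`.
  have hbase : Real.exp (-(4 * P)) ≤ 1 - P - γ := by
    have := exp_neg_two_mul_le_one_sub (q := 2 * P) (by linarith) (by linarith)
    rw [show -(4 * P) = -(2 * (2 * P)) by ring]
    linarith
  have hpow : Real.exp (-24) ≤ (1 - P - γ) ^ (N - 1) := by
    calc Real.exp (-24) ≤ Real.exp (N * -(4 * P)) := Real.exp_le_exp.2 (by nlinarith)
      _ = Real.exp (-(4 * P)) ^ N := Real.exp_nat_mul _ _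
      _ ≤ Real.exp (-(4 * P)) ^ (N - 1) :=
        pow_le_pow_of_le_one (Real.exp_pos _).le
          (Real.exp_le_one_iff.2 (by linarith)) (Nat.sub_le _ _)
      _ ≤ _ := pow_le_pow_left₀ (Real.exp_pos _).le hbase _
  have hhalf : Real.exp (-1) ≤ 1 / 2 := by
    have := Real.exp_neg_one_lt_d9
    linarith
  have hγ' : Real.exp (-1) * Real.exp (-1) ≤ N * γ := by
    have : N * (P / 2) ≤ N * γ := mul_le_mul_of_nonneg_left hγ0 hN
    nlinarith [Real.exp_pos (-1)]
  calc Real.exp (-26) = Real.exp (-1) * Real.exp (-1) * Real.exp (-24) := by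
        rw [← Real.exp_add, ← Real.exp_add]; norm_num
    _ ≤ _ := mul_le_mul hγ' hpow (Real.exp_pos _).le (by nlinarith)

/-- A number in `[0, 1 - a]` has `k`-th power at most `1/4` as soon as `a * k ≥ 2`. -/
theorem pow_le_quarter {k : ℕ} {x a : ℝ} (hx0 : 0 ≤ x) (hx : x ≤ 1 - a) (ha : 2 ≤ a * k) :
    x ^ k ≤ 1 / 4 := by
  have h1 : x ≤ Real.exp (-a) := by linarith [Real.add_one_le_exp (-a)]
  calc x ^ k ≤ Real.exp (-a) ^ k := pow_le_pow_left₀ hx0 h1 k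
    _ = Real.exp (k * -a) := (Real.exp_nat_mul _ _).symm
    _ ≤ Real.exp (-1 + -1) := Real.exp_le_exp.2 (by nlinarith)
    _ ≤ 1 / 4 := by
      rw [Real.exp_add]
      nlinarith [Real.exp_neg_one_lt_d9, Real.exp_pos (-1)]

/-! ### Uniform probabilities and Chebyshev's inequality -/

/-- The second moment of a sum of `s` independent copies of a centred variable bounded by `1`. -/
theorem sum_sq_sum_le {X : Type} [Fintype X] (φ : X → ℝ) (h0 : ∑ x, φ x = 0)
    (h1 : ∀ x, φ x ^ 2 ≤ 1) (s : ℕ) :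
    ∑ x : Fin s → X, (∑ i, φ (x i)) ^ 2 ≤ s * (Fintype.card X : ℝ) ^ s := by
  induction s with
  | zero => simp
  | succ s ih =>
    rw [← (Fin.consEquiv fun _ => X).sum_comp, Fintype.sum_prod_type]
    have hsq : ∀ (a : X) (x : Fin s → X),
        (∑ i, φ ((Fin.consEquiv fun _ => X) (a, x) i)) ^ 2 =
          φ a ^ 2 + φ a * (2 * ∑ i, φ (x i)) + (∑ i, φ (x i)) ^ 2 := by
      intro a x
      rw [Fin.sum_univ_succ]
      simp only [Fin.consEquiv_apply, Fin.cons_zero, Fin.cons_succ]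
      ring
    simp only [hsq, Finset.sum_add_distrib, ← Finset.mul_sum]
    rw [← Finset.sum_mul, h0, zero_mul, add_zero]
    have h2 : ∑ a : X, ∑ _x : Fin s → X, φ a ^ 2 ≤ (Fintype.card X : ℝ) ^ (s + 1) := by
      calc ∑ a : X, ∑ _x : Fin s → X, φ a ^ 2 ≤ ∑ _a : X, ∑ _x : Fin s → X, (1 : ℝ) :=
            Finset.sum_le_sum fun a _ => Finset.sum_le_sum fun _ _ => h1 a
        _ = (Fintype.card X : ℝ) ^ (s + 1) := by simp [pow_succ']
    have h3 : ∑ _a : X, ∑ x : Fin s → X, (∑ i, φ (x i)) ^ 2 ≤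
        Fintype.card X * (s * (Fintype.card X : ℝ) ^ s) := by
      rw [Finset.sum_const, Finset.card_univ, nsmul_eq_mul]
      exact mul_le_mul_of_nonneg_left ih (Nat.cast_nonneg _)
    push_cast
    rw [pow_succ'] at h2 ⊢
    linarith

theorem unifProb_eq {Ω : Type} [Fintype Ω] (P : Ω → Prop) [DecidablePred P] :
    unifProb P = ((Finset.univ.filter P).card : ℝ) / Fintype.card Ω := by
  unfold unifProb
  congr!

theorem unifProb_not {Ω : Type} [Fintype Ω] [Nonempty Ω] (P : Ω → Prop) :
    unifProb P = 1 - unifProb fun ω => ¬ P ω := by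
  classical
  have hΩ : (Fintype.card Ω : ℝ) ≠ 0 := by exact_mod_cast Fintype.card_ne_zero
  unfold unifProb
  rw [eq_sub_iff_add_eq, ← add_div, div_eq_one_iff_eq hΩ]
  have := Finset.card_filter_add_card_filter_not (s := (Finset.univ : Finset Ω)) P
  rw [Finset.card_univ] at this
  rw [← this]
  push_cast
  congr!

theorem unifProb_mono {Ω : Type} [Fintype Ω] {P Q : Ω → Prop} (h : ∀ ω, P ω → Q ω) :
    unifProb P ≤ unifProb Q := by
  classical
  rw [unifProb_eq, unifProb_eq]
  gcongr with ω hω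
  exact h ω

theorem unifProb_equiv {Ω Ω' : Type} [Fintype Ω] [Fintype Ω'] (e : Ω ≃ Ω') (P : Ω' → Prop) :
    unifProb (fun ω => P (e ω)) = unifProb P := by
  classical
  unfold unifProb
  rw [Fintype.card_congr e, ← Fintype.card_subtype, ← Fintype.card_subtype,
    Fintype.card_congr (e.subtypeEquiv (p := fun ω => P (e ω)) (q := P) fun _ => Iff.rfl)]

/-- Chebyshev's inequality for the empirical frequency of `f` in `s` independent samples. -/
theorem unifProb_abs_freq_sub_le {X : Type} [Fintype X] [Nonempty X] (f : X → Bool) {s : ℕ} {t : ℝ}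
    (hs : 0 < s) (ht : 0 < t) :
    1 - 1 / (s * t ^ 2) ≤ unifProb fun x : Fin s → X =>
      |((Finset.univ.filter fun i => f (x i) = true).card : ℝ) / s -
        unifProb fun x => f x = true| ≤ t := by
  classical
  set p : ℝ := unifProb fun x => f x = true with hp
  have hX : (0 : ℝ) < Fintype.card X := by exact_mod_cast Fintype.card_pos
  have hs' : (0 : ℝ) < s := by exact_mod_cast hs
  have hcard : ((Finset.univ.filter fun x => f x = true).card : ℝ) = p * Fintype.card X := by
    rw [hp, unifProb_eq, div_mul_cancel₀ _ hX.ne']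
  have hp0 : 0 ≤ p := by rw [hp]; unfold unifProb; positivity
  have hp1 : p ≤ 1 := by
    rw [hp, unifProb, div_le_one hX]
    exact_mod_cast Finset.card_le_univ _
  let φ : X → ℝ := fun x => (if f x = true then 1 else 0) - p
  have h0 : ∑ x, φ x = 0 := by
    simp only [φ, Finset.sum_sub_distrib, Finset.sum_boole, Finset.sum_const, Finset.card_univ,
      nsmul_eq_mul]
    rw [hcard]
    ring
  have h1 : ∀ x, φ x ^ 2 ≤ 1 := by
    intro x
    rw [sq_le_one_iff_abs_le_one, abs_le]
    by_cases h : f x = true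
    · simp only [φ, h, if_true]
      constructor <;> linarith
    · simp only [φ, if_neg h]
      constructor <;> linarith
  have hsum : ∀ x : Fin s → X, ∑ i, φ (x i) =
      s * (((Finset.univ.filter fun i => f (x i) = true).card : ℝ) / s - p) := by
    intro x
    simp only [φ, Finset.sum_sub_distrib, Finset.sum_boole, Finset.sum_const, Finset.card_univ,
      nsmul_eq_mul, Fintype.card_fin]
    field_simp
  have hV := sum_sq_sum_le φ h0 h1 s
  rw [unifProb_not, sub_le_sub_iff_left, unifProb_eq, div_le_div_iff₀ (by positivity) (by positivity)]
  set Bad := Finset.univ.filter fun x : Fin s → X =>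
    ¬ |((Finset.univ.filter fun i => f (x i) = true).card : ℝ) / s - p| ≤ t with hBad
  have h2 : (Bad.card : ℝ) * (s * t) ^ 2 ≤ s * (Fintype.card X : ℝ) ^ s := by
    refine le_trans ?_ hV
    rw [← nsmul_eq_mul, ← Finset.sum_const]
    refine (Finset.sum_le_sum fun x hx => ?_).trans
      (Finset.sum_le_univ_sum_of_nonneg fun x => sq_nonneg _)
    have hx : t < _ := not_le.1 (Finset.mem_filter.1 hx).2
    rw [hsum, mul_pow, mul_pow, ← sq_abs (_ / _ - p)]
    gcongr
  have h4 : (Fintype.card (Fin s → X) : ℝ) = (Fintype.card X : ℝ) ^ s := by simp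
  rw [h4]
  refine le_of_mul_le_mul_left ?_ hs'
  linarith

/-! ### Nonadaptive query algorithms -/

/-- The algorithm that queries its oracle at the points `xs 0, …, xs (m - 1)` and applies `g` to
the answers. -/
def queryFin {X α : Type} : (m : ℕ) → (Fin m → X) → ((Fin m → Bool) → α) → QueryAlg X α
  | 0, _, g => .output (g Fin.elim0)
  | m + 1, xs, g => .query (xs 0) fun b => queryFin m (Fin.tail xs) fun a => g (Fin.cons b a)

theorem run_queryFin {X α : Type} (f : X → Bool) (m : ℕ) (xs : Fin m → X)
    (g : (Fin m → Bool) → α) : (queryFin m xs g).run f = g fun i => f (xs i) := by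
  induction m with
  | zero => simp only [queryFin, QueryAlg.run]; congr 1; exact Subsingleton.elim _ _
  | succ m ih =>
    simp only [queryFin, QueryAlg.run, ih]
    congr 1
    funext i
    refine Fin.cases ?_ (fun i => ?_) i <;> simp [Fin.tail]

theorem numQueries_queryFin {X α : Type} (f : X → Bool) (m : ℕ) (xs : Fin m → X)
    (g : (Fin m → Bool) → α) : (queryFin m xs g).numQueries f = m := by
  induction m with
  | zero => rfl
  | succ m ih => simp only [queryFin, QueryAlg.numQueries, ih]

/-! ### Distance of the disjunction of conjunctions -/

/-- The disjunction over `S` of conjunctions of copies of `h` is far from monotone if `h` has a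
matching of violations whose density is at least `2 / |I|`, where `|I|` is the width of the
conjunctions, and if `S` has the size prescribed by a good estimate `x` of the density of `h`. -/
theorem IsViolMatching.exp_neg_le_unifProb_ne {X I J : Type} [Fintype X] [Nonempty X] [Fintype I]
    [DecidableEq I] [Fintype J] [DecidableEq J] [Preorder X] {h : X → Bool} {L : Finset X}
    {σ : X → X} (hm : IsViolMatching h L σ) {x : ℝ} (hx : 1 / 2 ≤ x) (hx1 : x ≤ 1)
    (hI : 0 < Fintype.card I) (hL : 2 ≤ (L.card : ℝ) / Fintype.card X * Fintype.card I)
    (hp : 1 / 2 ≤ unifProb fun v => h v = true)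
    (hxp : |x - unifProb fun v => h v = true| ≤ 1 / (2 * Fintype.card I))
    {S : Finset J} (hS : S.card = numTerms (Fintype.card I) x)
    {g : (J → I → X) → Bool} (hg : Monotone g) :
    Real.exp (-26) ≤ unifProb fun z => MonoAmp.orOver S (MonoAmp.andPower h) z ≠ g z := by
  set k := Fintype.card I with hk
  set p : ℝ := unifProb fun v => h v = true with hpdef
  set a : ℝ := (L.card : ℝ) / Fintype.card X with hadef
  rw [unifProb_eq] at hpdef
  have hX : (0 : ℝ) < Fintype.card X := by exact_mod_cast Fintype.card_pos
  have hLT : L.card ≤ (Finset.univ.filter fun v => h v = true).card :=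
    Finset.card_le_card fun v hv => by simpa using hm.high v hv
  have hLF : L.card ≤ (Finset.univ.filter fun v => ¬ h v = true).card :=
    Finset.card_le_card_of_injOn σ
      (fun v hv => by simpa using hm.low v hv) hm.injOn
  have hTF := Finset.card_filter_add_card_filter_not (s := (Finset.univ : Finset X))
    (fun v => h v = true)
  have ha0 : 0 ≤ a := by positivity
  have hap : a ≤ p := by rw [hadef, hpdef]; gcongr
  have hpa : p ≤ 1 - a := by
    rw [le_sub_iff_add_le, hadef, hpdef, ← add_div, div_le_one hX]
    rw [Finset.card_univ] at hTF
    exact_mod_cast (by omega)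
  have hp1 : p ≤ 1 := by linarith
  obtain ⟨G, φ, hG, hGcard⟩ := hm.andPower (I := I)
  obtain ⟨A, Φ, hA, hAcard⟩ := hG.orOver S
  have hW : (Fintype.card (I → X) : ℝ) = (Fintype.card X : ℝ) ^ k := by simp [hk]
  have hP : ((Finset.univ.filter fun w : I → X => MonoAmp.andPower h w = true).card : ℝ) /
      Fintype.card (I → X) = p ^ k := by
    rw [card_andPower, hW, hpdef, div_pow]
    push_cast
    rfl
  have hγ : (G.card : ℝ) / Fintype.card (I → X) = p ^ k - (p - a) ^ k := by
    have h1 := congrArg (fun m : ℕ => (m : ℝ)) hGcard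
    push_cast [Nat.cast_sub hLT] at h1
    rw [hW, hpdef, hadef, ← sub_div, div_pow, div_pow, ← sub_div, ← h1]
    congr 1
    ring
  rw [hP, hγ, hS] at hAcard
  have hsmall : (p - a) ^ k ≤ p ^ k * (1 / 4) := by
    calc (p - a) ^ k ≤ (p * (1 - a)) ^ k :=
          pow_le_pow_left₀ (by linarith) (by nlinarith) k
      _ = p ^ k * (1 - a) ^ k := mul_pow _ _ _
      _ ≤ p ^ k * (1 / 4) := mul_le_mul_of_nonneg_left
          (pow_le_quarter (by linarith) le_rfl hL) (by positivity)
  have hpk : 0 ≤ p ^ k := by positivity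
  have hmain := exp_neg_le_of_numTerms (exp_neg_one_le_numTerms_mul hI hx hp hxp)
    (numTerms_mul_le hI hx hx1 hp hxp) hpk (pow_le_quarter (by linarith) hpa hL)
    (γ := p ^ k - (p - a) ^ k) (by linarith)
    (by linarith [pow_nonneg (by linarith : 0 ≤ p - a) k])
  rw [← hAcard] at hmain
  refine hmain.trans ?_
  rw [unifProb_eq]
  exact div_le_div_of_nonneg_right (by exact_mod_cast hA.card_le_card_ne hg) (Nat.cast_nonneg _)

/-! ### Padding with a fair bit -/

/-- The first coordinate of a point of the cube, and `false` if there is none. -/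
def firstBit {n : ℕ} (y : Cube n) : Bool :=
  if h : 0 < n then y ⟨0, h⟩ else false

/-- The disjunction of `f` with an independent fair bit. For every `f` it has density at least
`1/2`. -/
def padded {n : ℕ} (f : Cube n → Bool) (v : Cube n × Cube n) : Bool :=
  f v.1 || firstBit v.2

theorem monotone_padded {n : ℕ} {f : Cube n → Bool} (hf : Monotone f) : Monotone (padded f) := by
  intro v w hvw
  refine sup_le_sup (hf hvw.1) ?_
  unfold firstBit
  split_ifs with h
  · exact hvw.2 _
  · exact le_rfl

theorem unifProb_firstBit_eq_false {n : ℕ} (hn : 0 < n) :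
    unifProb (fun y : Cube n => firstBit y = false) = 1 / 2 := by
  have h1 := unifProb_not fun y : Cube n => firstBit y = false
  have h2 := unifProb_equiv
    (Function.Involutive.toPerm (fun (y : Cube n) i => !y i) fun y => by simp)
    fun y => ¬ firstBit y = false
  -- Negating all coordinates is a bijection that negates the first bit.
  have h3 : (fun y : Cube n => ¬ firstBit
      (Function.Involutive.toPerm (fun (y : Cube n) i => !y i) (fun y => by simp) y) = false) =
      fun y => firstBit y = false := by
    funext y
    simp [firstBit, hn]
    rfl
  rw [h3] at h2
  linarith

theorem unifProb_padded {n : ℕ} (hn : 0 < n) (f : Cube n → Bool) :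
    unifProb (fun v => padded f v = true) = 1 / 2 + (unifProb fun x => f x = true) / 2 := by
  have h1 := unifProb_firstBit_eq_false hn
  have h2 : (Finset.univ.filter fun v => ¬ padded f v = true) =
      (Finset.univ.filter fun x => ¬ f x = true) ×ˢ
        (Finset.univ.filter fun y : Cube n => firstBit y = false) := by
    ext v
    simp [padded]
  have h3 : unifProb (fun v => ¬ padded f v = true) =
      (unifProb fun x => ¬ f x = true) * unifProb (fun y : Cube n => firstBit y = false) := by
    rw [unifProb_eq, unifProb_eq, unifProb_eq, h2, Finset.card_product, Fintype.card_prod]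
    push_cast
    rw [mul_div_mul_comm]
  rw [unifProb_not, h3, h1, unifProb_not fun x => f x = true]
  ring

theorem IsViolMatching.padded {n : ℕ} {f : Cube n → Bool} {L : Finset (Cube n)}
    {σ : Cube n → Cube n} (hm : IsViolMatching f L σ) :
    IsViolMatching (padded f) (L ×ˢ Finset.univ.filter fun y => firstBit y = false)
      fun v => (σ v.1, v.2) := by
  refine ⟨?_, ?_, ?_, ?_⟩
  · intro v hv w hw hvw
    have hv := (Finset.mem_product.1 hv).1
    have hw := (Finset.mem_product.1 hw).1
    rw [Prod.mk.injEq] at hvw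
    exact Prod.ext (hm.injOn hv hw hvw.1) hvw.2
  · intro v hv
    exact ⟨hm.le _ (Finset.mem_product.1 hv).1, le_rfl⟩
  · intro v hv
    simp [MonoAmp.padded, hm.high _ (Finset.mem_product.1 hv).1]
  · intro v hv
    rw [Finset.mem_product, Finset.mem_filter] at hv
    simp [MonoAmp.padded, hm.low _ hv.1, hv.2.2]

/-! ### Distance from monotonicity -/

instance nonempty_monotone {n : ℕ} : Nonempty {g : Cube n → Bool // Monotone g} :=
  ⟨⟨fun _ => false, monotone_const⟩⟩

theorem unifProb_nonneg {Ω : Type} [Fintype Ω] (P : Ω → Prop) : 0 ≤ unifProb P := by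
  unfold unifProb
  positivity

theorem unifProb_of_forall {Ω : Type} [Fintype Ω] [Nonempty Ω] {P : Ω → Prop} (h : ∀ ω, P ω) :
    unifProb P = 1 := by
  classical
  rw [unifProb_eq, Finset.filter_true_of_mem fun ω _ => h ω, Finset.card_univ]
  exact div_self (by exact_mod_cast Fintype.card_ne_zero)

theorem monoDist_le {n : ℕ} (f : Cube n → Bool) {g : Cube n → Bool} (hg : Monotone g) :
    monoDist f ≤ unifProb fun x => f x ≠ g x := by
  refine ciInf_le (f := fun g : {g : Cube n → Bool // Monotone g} =>
    unifProb fun x => f x ≠ g.1 x) ⟨0, ?_⟩ ⟨g, hg⟩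
  rintro _ ⟨g, rfl⟩
  exact unifProb_nonneg _

theorem monoDist_cube_zero_le (f : Cube 0 → Bool) : monoDist f ≤ 0 := by
  refine (monoDist_le f (g := f) fun x y _ => (congrArg f (Subsingleton.elim x y)).le).trans ?_
  rw [unifProb_eq]
  simp

/-- Covering violations by a matching loses a factor `2`, and padding loses another. -/
theorem exists_violMatching_padded {n : ℕ} (hn : 0 < n) (f : Cube n → Bool) :
    ∃ (L : Finset (Cube n × Cube n)) (σ : Cube n × Cube n → Cube n × Cube n),
      IsViolMatching (padded f) L σ ∧
        monoDist f / 4 ≤ (L.card : ℝ) / Fintype.card (Cube n × Cube n) := by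
  obtain ⟨L, σ, g, hm, hg, hcard⟩ := exists_violMatching f
  refine ⟨_, _, hm.padded, ?_⟩
  have h1 := unifProb_firstBit_eq_false hn
  have h2 := monoDist_le f hg
  rw [unifProb_eq] at h1 h2
  rw [Finset.card_product, Fintype.card_prod]
  push_cast
  rw [mul_div_mul_comm, h1]
  have h3 : ((Finset.univ.filter fun x => f x ≠ g x).card : ℝ) / Fintype.card (Cube n) ≤
      (2 * L.card : ℝ) / Fintype.card (Cube n) := by
    gcongr
    exact_mod_cast hcard
  rw [mul_div_assoc] at h3
  linarith

/-! ### The transformation -/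

/-- The coordinates of a point, grouped into blocks that are points of `Cube n × Cube n`. -/
def blocks {n n' : ℕ} {J I : Type} (e : Fin n' ≃ J × I × (Fin n ⊕ Fin n)) :
    Cube n' ≃o (J → I → Cube n × Cube n) where
  toFun z j i := (fun l => z (e.symm (j, i, .inl l)), fun l => z (e.symm (j, i, .inr l)))
  invFun w m := (e m).2.2.elim (w (e m).1 (e m).2.1).1 (w (e m).1 (e m).2.1).2
  left_inv z := by
    funext m
    obtain ⟨⟨j, i, l | l⟩, rfl⟩ := e.symm.surjective m <;> simp
  right_inv w := by
    funext j i
    simp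
  map_rel_iff' := by
    intro z z'
    refine ⟨fun h m => ?_, fun h j i => ⟨fun l => h _, fun l => h _⟩⟩
    obtain ⟨⟨j, i, l | l⟩, rfl⟩ := e.symm.surjective m
    · exact (h j i).1 l
    · exact (h j i).2 l

/-- The bijection between the coin tosses and the `s` uniform samples that they encode. -/
def coinsEquiv (s n : ℕ) : (Fin (s * n) → Bool) ≃ (Fin s → Cube n) :=
  (Equiv.arrowCongr finProdFinEquiv.symm (Equiv.refl Bool)).trans (Equiv.curry _ _ _)

/-- The estimate of the density of `padded f` when `a` lists the values of `f` at the samples. -/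
noncomputable def estimate {s : ℕ} (a : Fin s → Bool) : ℝ :=
  1 / 2 + ((Finset.univ.filter fun i => a i = true).card : ℝ) / s / 2

theorem half_le_estimate {s : ℕ} (a : Fin s → Bool) : 1 / 2 ≤ estimate a := by
  unfold estimate
  have : 0 ≤ ((Finset.univ.filter fun i => a i = true).card : ℝ) / s / 2 := by positivity
  linarith

theorem estimate_le_one {s : ℕ} (a : Fin s → Bool) : estimate a ≤ 1 := by
  unfold estimate
  have h : (Finset.univ.filter fun i => a i = true).card ≤ s :=
    (Finset.card_le_univ _).trans (Fintype.card_fin s).le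
  have : ((Finset.univ.filter fun i => a i = true).card : ℝ) / s ≤ 1 :=
    div_le_one_of_le₀ (by exact_mod_cast h) (Nat.cast_nonneg s)
  linarith

/-- The terms that take part in the disjunction when the density is estimated to be `x`. -/
noncomputable def activeTerms (k : ℕ) (x : ℝ) : Finset (Fin (2 ^ k)) :=
  Finset.univ.filter fun j => j.val < numTerms k x

theorem card_activeTerms {k : ℕ} {x : ℝ} (hx : 1 / 2 ≤ x) :
    (activeTerms k x).card = numTerms k x := by
  rw [activeTerms, Fin.card_filter_val_lt, min_eq_right (numTerms_le hx)]

/-- The transformation that estimates the density of `padded f` from `s` samples and returns the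
disjunction of conjunctions of `k` copies of `padded f` whose number of terms fits the estimate.
A query to the new function reads `f` in all `2 ^ k * k` blocks, used or not. -/
noncomputable def amplifier {n n' : ℕ} (s k : ℕ)
    (e : Fin n' ≃ Fin (2 ^ k) × Fin k × (Fin n ⊕ Fin n)) : OracleTransform n n' where
  numCoins := s * n
  alg r := queryFin s (coinsEquiv s n r) fun a z =>
    queryFin (2 ^ k * k)
      (fun m => (blocks e z (finProdFinEquiv.symm m).1 (finProdFinEquiv.symm m).2).1) fun b =>
        decide (∃ j ∈ activeTerms k (estimate a), ∀ i,
          (b (finProdFinEquiv (j, i)) || firstBit (blocks e z j i).2) = true)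

section

variable {n n' s k : ℕ} (e : Fin n' ≃ Fin (2 ^ k) × Fin k × (Fin n ⊕ Fin n))

theorem result_amplifier (r : Fin (amplifier s k e).numCoins → Bool) (f : Cube n → Bool)
    (z : Cube n') :
    (amplifier s k e).result r f z =
      orOver (activeTerms k (estimate fun i => f (coinsEquiv s n r i))) (andPower (padded f))
        (blocks e z) := by
  simp [OracleTransform.result, OracleTransform.simulator, amplifier, run_queryFin, orOver,
    andPower, padded, -finProdFinEquiv_symm_apply]

theorem setupQueries_amplifier (r : Fin (amplifier s k e).numCoins → Bool) (f : Cube n → Bool) :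
    (amplifier s k e).setupQueries r f = s :=
  numQueries_queryFin _ _ _ _

theorem simQueries_amplifier (r : Fin (amplifier s k e).numCoins → Bool) (f : Cube n → Bool)
    (z : Cube n') :
    (amplifier s k e).simQueries r f z = 2 ^ k * k := by
  simp only [OracleTransform.simQueries, OracleTransform.simulator, amplifier, run_queryFin,
    numQueries_queryFin]

theorem monotone_result_amplifier (r : Fin (amplifier s k e).numCoins → Bool)
    {f : Cube n → Bool} (hf : Monotone f) :
    Monotone ((amplifier s k e).result r f) := by
  intro z z' hz
  rw [result_amplifier, result_amplifier]
  exact monotone_orOver _ (monotone_andPower (monotone_padded hf)) ((blocks e).monotone hz)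

theorem exp_neg_le_monoDist_result_amplifier (hn : 0 < n) (hk : 0 < k) {f : Cube n → Bool}
    (hf : 8 ≤ monoDist f * k) (r : Fin (amplifier s k e).numCoins → Bool)
    (hr : |((Finset.univ.filter fun i => f (coinsEquiv s n r i) = true).card : ℝ) / s -
      unifProb fun x => f x = true| ≤ 1 / k) :
    Real.exp (-26) ≤ monoDist ((amplifier s k e).result r f) := by
  obtain ⟨L, σ, hm, hL⟩ := exists_violMatching_padded hn f
  refine le_ciInf fun ⟨g, hg⟩ => ?_
  have hx := half_le_estimate fun i => f (coinsEquiv s n r i)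
  have hk' : (0 : ℝ) < k := by exact_mod_cast hk
  have hmain := hm.exp_neg_le_unifProb_ne (I := Fin k) (J := Fin (2 ^ k)) hx
    (estimate_le_one _) (by simpa using hk)
    (by rw [Fintype.card_fin]; nlinarith)
    (by rw [unifProb_padded hn]; linarith [unifProb_nonneg fun x => f x = true])
    (by
      rw [unifProb_padded hn, Fintype.card_fin, estimate, add_sub_add_left_eq_sub, ← sub_div,
        abs_div, abs_two, div_le_iff₀ two_pos]
      refine hr.trans (le_of_eq ?_)
      field_simp)
    (S := activeTerms k (estimate fun i => f (coinsEquiv s n r i)))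
    (by rw [card_activeTerms hx, Fintype.card_fin])
    (hg.comp (blocks e).symm.monotone)
  rw [← unifProb_equiv (blocks e).toEquiv] at hmain
  refine hmain.trans (unifProb_mono fun z hz => ?_)
  rw [result_amplifier]
  simpa using hz

end

/-! ### Parameters -/

theorem ten_mul_le_two_pow {k : ℕ} (hk : 8 ≤ k) : 10 * k ≤ 2 ^ k := by
  induction k, hk using Nat.le_induction with
  | base => norm_num
  | succ k hk ih => rw [pow_succ]; omega

theorem twoPowTheta_of_le {ε q : ℝ} {k : ℕ} (hk : 8 * max 1 (1 / ε) ≤ k)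
    (hk' : (k : ℝ) ≤ 9 * max 1 (1 / ε)) (h1 : 2 ^ k ≤ q) (h2 : q ≤ 2 ^ (3 * k)) :
    TwoPowTheta 8 27 ε q := by
  constructor
  · refine le_trans ?_ h1
    rw [← Real.rpow_natCast]
    exact Real.rpow_le_rpow_of_exponent_le one_le_two hk
  · refine h2.trans ?_
    rw [← Real.rpow_natCast]
    refine Real.rpow_le_rpow_of_exponent_le one_le_two ?_
    push_cast
    linarith

end MonoAmp

open MonoAmp in
theorem lemma1p2 :
    ∃ δ : ℝ, 0 < δ ∧ ∃ c C : ℝ, 0 < c ∧ 0 < C ∧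
      ∀ ε : ℝ, 0 < ε → ∀ n : ℕ, ∃ (n' : ℕ) (T : MonoAmp.OracleTransform n n'),
        (∀ (r : Fin T.numCoins → Bool) (f : MonoAmp.Cube n → Bool),
          MonoAmp.TwoPowTheta c C ε (T.setupQueries r f)) ∧
        (∃ K : ℝ, MonoAmp.TwoPowTheta c C ε K ∧ (n' : ℝ) = n * K) ∧
        (∀ (r : Fin T.numCoins → Bool) (f : MonoAmp.Cube n → Bool) (z : MonoAmp.Cube n'),
          MonoAmp.TwoPowTheta c C ε (T.simQueries r f z)) ∧
        (∀ f : MonoAmp.Cube n → Bool, Monotone f →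
          MonoAmp.unifProb (fun r : Fin T.numCoins → Bool => Monotone (T.result r f)) = 1) ∧
        (∀ f : MonoAmp.Cube n → Bool, ε ≤ MonoAmp.monoDist f →
          (0.99 : ℝ) ≤ MonoAmp.unifProb
            (fun r : Fin T.numCoins → Bool => δ ≤ MonoAmp.monoDist (T.result r f))) := by
  refine ⟨Real.exp (-26), Real.exp_pos _, 8, 27, by norm_num, by norm_num, fun ε hε n => ?_⟩
  have hL1 : 1 ≤ max 1 (1 / ε) := le_max_left _ _
  obtain ⟨k, hk, hk'⟩ : ∃ k : ℕ, 8 * max 1 (1 / ε) ≤ k ∧ (k : ℝ) ≤ 9 * max 1 (1 / ε) :=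
    ⟨⌈8 * max 1 (1 / ε)⌉₊, Nat.le_ceil _, by
      have := Nat.ceil_lt_add_one (by positivity : 0 ≤ 8 * max 1 (1 / ε))
      linarith⟩
  have hk8 : 8 ≤ k := by
    have : (8 : ℝ) ≤ k := by linarith
    exact_mod_cast this
  have hk0 : (0 : ℝ) < k := by linarith
  have h10 : (10 * k : ℝ) ≤ 2 ^ k := by exact_mod_cast ten_mul_le_two_pow hk8
  have hpow : (0 : ℝ) < 2 ^ k := by positivity
  have htwo : (2 : ℝ) ^ (2 * k) = 2 ^ k * 2 ^ k := by rw [two_mul, pow_add]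
  have hthree : (2 : ℝ) ^ (3 * k) = 2 ^ k * 2 ^ k * 2 ^ k := by
    rw [← pow_add, ← pow_add]; congr 1; ring
  have hone : (1 : ℝ) ≤ 2 ^ k := one_le_pow₀ one_le_two
  have hcard : Fintype.card (Fin (2 ^ k) × Fin k × (Fin n ⊕ Fin n)) = 2 ^ k * k * (2 * n) := by
    simp only [Fintype.card_prod, Fintype.card_sum, Fintype.card_fin]
    ring
  let e := (Fintype.equivFinOfCardEq hcard).symm
  refine ⟨_, amplifier (2 ^ (2 * k)) k e, fun r f => ?_, ⟨2 ^ k * k * 2, ?_, ?_⟩,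
    fun r f z => ?_, fun f hf => ?_, fun f hf => ?_⟩
  · refine twoPowTheta_of_le hk hk' ?_ ?_
    · rw [setupQueries_amplifier]
      push_cast
      exact pow_le_pow_right₀ one_le_two (by omega)
    · rw [setupQueries_amplifier]
      push_cast
      exact pow_le_pow_right₀ one_le_two (by omega)
  · refine twoPowTheta_of_le hk hk' ?_ ?_
    · nlinarith
    · rw [hthree]
      have h1 : (2 : ℝ) ^ k * k * 2 ≤ 2 ^ k * 2 ^ k := by nlinarith
      nlinarith
  · push_cast
    ring
  · refine twoPowTheta_of_le hk hk' ?_ ?_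
    · rw [simQueries_amplifier]
      push_cast
      nlinarith
    · rw [simQueries_amplifier, hthree]
      push_cast
      have h1 : (2 : ℝ) ^ k * k ≤ 2 ^ k * 2 ^ k := by nlinarith
      nlinarith
  · exact unifProb_of_forall fun r => monotone_result_amplifier e r hf
  -- On the cube of dimension `0` there is no padding bit, but every function is monotone.
  · rcases Nat.eq_zero_or_pos n with rfl | hn
    · linarith [monoDist_cube_zero_le f]
    · have hfk : 8 ≤ monoDist f * k := by
        have h1 : 1 / ε ≤ max 1 (1 / ε) := le_max_right _ _
        have h2 : 8 * (1 / ε) ≤ k := by linarith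
        have h3 : ε * (8 * (1 / ε)) = 8 := by field_simp
        calc (8 : ℝ) = ε * (8 * (1 / ε)) := h3.symm
          _ ≤ monoDist f * k := mul_le_mul hf h2 (by positivity) (hε.le.trans hf)
      have hcheb := unifProb_abs_freq_sub_le f (s := 2 ^ (2 * k)) (t := 1 / k)
        (by positivity) (by positivity)
      rw [← unifProb_equiv (coinsEquiv (2 ^ (2 * k)) n)] at hcheb
      refine le_trans ?_ (hcheb.trans (unifProb_mono fun r hr =>
        exp_neg_le_monoDist_result_amplifier e hn (by omega) hfk r hr))
      -- The error probability `1 / (4 ^ k * k⁻²)` is at most `1 / 100`, as `10 * k ≤ 2 ^ k`.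
      have h100 : (100 : ℝ) ≤ ((2 ^ (2 * k) : ℕ) : ℝ) * (1 / k) ^ 2 := by
        push_cast
        rw [htwo, div_pow, one_pow, mul_one_div, le_div_iff₀ (by positivity)]
        nlinarith
      have := one_div_le_one_div_of_le (by norm_num) h100
      norm_num at this ⊢
      linarith
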